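/- **Theorem (B-series of the exact solution).** A *TW-tree* is an (unordered) rooted tree whose nodes are coloured meagre or fat, such that every end vertex is meagre and every fat vertex has exactly one child; $T\subset TW$ is the set of TW-trees without fat nodes (the ordinary Butcher trees). For $\tau\in TW$ let $|\tau|$ be the number of nodes, $\sigma(\tau)$ the order of the symmetry group, and $\gamma(\tau)$ the density, i.e. the product over all vertices of the orders of the sub-trees rooted at those vertices. For $f:\mathbb{R}^N\to\mathbb{R}^N$ and a matrix $\mathbf{A}\in\mathbb{R}^{N\times N}$ (the approximate Jacobian) the elementary differential $F(\tau)(y)$ is defined recursively: if the root is meagre with branches $\tau_1,\dots,\tau_m$ ($m\ge 0$), then $F(\tau)(y)=f^{(m)}(y)\bigl(F(\tau_1)(y),\dots,F(\tau_m)(y)\bigr)$; if the root is fat with branch $\tau_1$, then $F(\tau)(y)=\mathbf{A}\,F(\tau_1)(y)$. For $\mathsf{a}:TW\cup\{\emptyset\}\to\mathbb{R}$ the B-series is the formal series in $h$ $$B(\mathsf{a},y)=\mathsf{a}(\emptyset)\,y+\sum_{\tau\in TW}\mathsf{a}(\tau)\,\frac{h^{|\tau|}}{\sigma(\tau)}\,F(\tau)(y).$$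 There is exactly one map $\mathsf{a}:TW\cup\{\emptyset\}\to\mathbb{R}$ such that, for all $N$, all $f:\mathbb{R}^N\to\mathbb{R}^N$, all $\mathbf{A}\in\mathbb{R}^{N\times N}$, and every exact solution $y$ of $y'=f(y)$, $y(t_n)=y_n$, on an interval $[t_n,t_1]$ with $t_1>t_n$ and $f$ smooth at $y_n$, the series $B(\mathsf{a},y_n)$ is the expansion of $y(t_n+h)$ in powers of $h$; that is, for each $p\ge 0$, $y(t_n+h)$ differs from the sum of the terms of $B(\mathsf{a},y_n)$ of order at most $p$ in $h$ by $O(h^{p+1})$ as $h\to 0^+$. These coefficients of the exact solution are $\mathsf{a}(\emptyset)=1$ and $$\mathsf{a}(\tau)=\begin{cases}0, & \tau\in TW\smallsetminus T,\\[2pt] \dfrac{1}{\gamma(\tau)}, & \tau\in T.\end{cases}$$ -/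

import Mathlib

open scoped ContDiff Topology Matrix

noncomputable section

namespace TW

theorem fderiv_apply_tail {E F : Type*} [NormedAddCommGroup E] [NormedSpace ℝ E]
    [NormedAddCommGroup F] [NormedSpace ℝ F] {f : E → F} {x : E} {n : ℕ}
    (hf : ContDiffAt ℝ (n + 1 : ℕ) f x) (u : E) (w : Fin n → E) :
    fderiv ℝ (iteratedFDeriv ℝ n f) x u w
      = fderiv ℝ (fun x' => iteratedFDeriv ℝ n f x' w) x u := by
  have hd : DifferentiableAt ℝ (iteratedFDeriv ℝ n f) x :=
    hf.differentiableAt_iteratedFDeriv (by exact_mod_cast Nat.lt_succ_self n)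
  exact congrArg (fun L => L u)
    (((ContinuousMultilinearMap.apply ℝ (fun _ : Fin n => E) F w).hasFDerivAt.comp x
      hd.hasFDerivAt).fderiv).symm

/-- Symmetry of the iterated derivatives of a sufficiently smooth function. -/
theorem iteratedFDeriv_comp_perm {E F : Type*} [NormedAddCommGroup E] [NormedSpace ℝ E]
    [NormedAddCommGroup F] [NormedSpace ℝ F] {f : E → F} (n : ℕ) :
    ∀ {x : E}, ContDiffAt ℝ n f x → ∀ (e : Equiv.Perm (Fin n)) (v : Fin n → E),
      iteratedFDeriv ℝ n f x (v ∘ e) = iteratedFDeriv ℝ n f x v := by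
  induction n with
  | zero =>
      intro x _ e v
      exact congrArg _ (Subsingleton.elim _ _)
  | succ n ih =>
      intro x hf e
      have he : e ∈ Submonoid.closure
          (Set.range fun i : Fin n => Equiv.swap i.castSucc i.succ) := by
        rw [Equiv.Perm.mclosure_swap_castSucc_succ]; trivial
      induction he using Submonoid.closure_induction with
      | one => intro v; rfl
      | mul a b _ _ ha hb =>
          intro v
          rw [← ha v, ← hb (v ∘ a)]; rfl
      | mem a ha =>
          obtain ⟨i, rfl⟩ := ha
          intro v
          obtain ⟨m, rfl⟩ : ∃ m, n = m + 1 := ⟨n - 1, by have := i.isLt; omega⟩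
          rw [iteratedFDeriv_succ_apply_left, iteratedFDeriv_succ_apply_left,
            fderiv_apply_tail hf, fderiv_apply_tail hf]
          have hev : ∀ᶠ x' in 𝓝 x, ContDiffAt ℝ (m + 1 : ℕ) f x' :=
            (hf.of_le (by exact_mod_cast Nat.le_succ _)).eventually (by simp)
          induction i using Fin.cases with
          | zero =>
              have key : ∀ w : Fin (m + 1 + 1) → E,
                  fderiv ℝ (fun x' => iteratedFDeriv ℝ (m + 1) f x' (Fin.tail w)) x (w 0)
                  = fderiv ℝ (fderiv ℝ fun x' =>
                      iteratedFDeriv ℝ m f x' (Fin.tail (Fin.tail w))) x (w 0) (w 1) := by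
                intro w
                have h1 : (fun x' => iteratedFDeriv ℝ (m + 1) f x' (Fin.tail w)) =ᶠ[𝓝 x]
                    fun x' => fderiv ℝ (fun x'' =>
                      iteratedFDeriv ℝ m f x'' (Fin.tail (Fin.tail w))) x' (w 1) := by
                  filter_upwards [hev] with x' hx'
                  rw [iteratedFDeriv_succ_apply_left, fderiv_apply_tail hx']
                  rfl
                rw [h1.fderiv_eq]
                have hc : ContDiffAt ℝ 2 (fun x' =>
                    iteratedFDeriv ℝ m f x' (Fin.tail (Fin.tail w))) x :=
                  (ContinuousMultilinearMap.apply ℝ (fun _ : Fin m => E) F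
                    (Fin.tail (Fin.tail w))).contDiff.contDiffAt.comp x
                    (hf.iteratedFDeriv_right (m := 2) (i := m) (by push_cast; ring_nf; rfl))
                have hd : DifferentiableAt ℝ (fderiv ℝ fun x' =>
                    iteratedFDeriv ℝ m f x' (Fin.tail (Fin.tail w))) x :=
                  (hc.fderiv_right (m := 1) (by norm_num)).differentiableAt (by norm_num)
                exact congrArg (fun L => L (w 0))
                  (((ContinuousLinearMap.apply ℝ F (w 1)).hasFDerivAt.comp x
                    hd.hasFDerivAt).fderiv)
              have hc : ContDiffAt ℝ 2 (fun x' =>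
                  iteratedFDeriv ℝ m f x' (Fin.tail (Fin.tail v))) x :=
                (ContinuousMultilinearMap.apply ℝ (fun _ : Fin m => E) F
                  (Fin.tail (Fin.tail v))).contDiff.contDiffAt.comp x
                  (hf.iteratedFDeriv_right (m := 2) (i := m) (by push_cast; ring_nf; rfl))
              have hs := hc.isSymmSndFDerivAt (by simp)
              rw [key, key]
              have ht : Fin.tail (Fin.tail (v ∘ Equiv.swap (Fin.castSucc 0) (Fin.succ 0)))
                  = Fin.tail (Fin.tail v) := by
                funext k
                simp only [Fin.tail, Function.comp_apply]
                rw [Equiv.swap_apply_of_ne_of_ne]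
                · simp [Fin.ext_iff]
                · simp [Fin.ext_iff]
              rw [ht]
              have h0 : (v ∘ Equiv.swap (Fin.castSucc 0) (Fin.succ 0)) (0 : Fin (m + 1 + 1)) = v 1 := by
                simp
              have h1 : (v ∘ Equiv.swap (Fin.castSucc 0) (Fin.succ 0)) (1 : Fin (m + 1 + 1)) = v 0 := by
                simp
              rw [h0, h1]
              exact hs _ _
          | succ j =>
              have h0 : (v ∘ Equiv.swap j.succ.castSucc j.succ.succ) 0 = v 0 := by
                simp only [Function.comp_apply]
                rw [Equiv.swap_apply_of_ne_of_ne]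
                · simp [Fin.ext_iff]
                · simp [Fin.ext_iff]
              have ht : Fin.tail (v ∘ Equiv.swap j.succ.castSucc j.succ.succ)
                  = Fin.tail v ∘ Equiv.swap j.castSucc j.succ := by
                funext k
                simp only [Fin.tail, Function.comp_apply]
                congr 1
                rw [← Fin.succ_castSucc,
                  (Fin.succ_injective _).map_swap]
              rw [h0, ht]
              congr 1
              apply Filter.EventuallyEq.fderiv_eq
              filter_upwards [hev] with x' hx'
              exact ih hx' _ _

/-- Plane (ordered) representatives of TW-trees: rooted trees with meagre (full) and fat (empty)
nodes. A meagre node has any number of children (none: a leaf), a fat node has exactly one child,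
so every end vertex is meagre and every fat vertex is singly branched. -/
inductive PlaneTree : Type
  | meagre (n : ℕ) (c : Fin n → PlaneTree) : PlaneTree
  | fat (c : PlaneTree) : PlaneTree

namespace PlaneTree

/-- Isomorphisms of rooted two-coloured trees (forgetting the order of the children): the roots have
the same colour, and the branches at the two roots are matched by a bijection, together with an
isomorphism for each pair of matched branches. -/
def Iso : PlaneTree → PlaneTree → Type
  | meagre n c, meagre m d => Σ e : Fin n ≃ Fin m, ∀ i, Iso (c i) (d (e i))
  | fat a, fat b => Iso a b
  | meagre _ _, fat _ => Empty
  | fat _, meagre _ _ => Empty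

def Iso.refl : ∀ t : PlaneTree, Iso t t
  | meagre _ c => ⟨Equiv.refl _, fun i => Iso.refl (c i)⟩
  | fat a => Iso.refl a

def Iso.symm : ∀ {t s : PlaneTree}, Iso t s → Iso s t
  | meagre _ c, meagre _ d, i =>
      ⟨i.1.symm, fun k => Iso.symm (t := c (i.1.symm k)) (s := d k)
        (cast (congrArg (fun l => Iso (c (i.1.symm k)) (d l)) (i.1.apply_symm_apply k))
          (i.2 (i.1.symm k)))⟩
  | fat a, fat b, i => Iso.symm (t := a) (s := b) i
  | meagre _ _, fat _, i => i.elim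
  | fat _, meagre _ _, i => i.elim

/-- Composing with an isomorphism on the left is a bijection of sets of isomorphisms. -/
def Iso.congrLeft : ∀ {t s : PlaneTree}, Iso t s → ∀ u : PlaneTree, Iso s u ≃ Iso t u
  | meagre _ c, meagre _ d, i, meagre _ w =>
      Equiv.sigmaCongr (Equiv.equivCongr i.1.symm (Equiv.refl _)) fun e' =>
        (Equiv.piCongr (W := fun k => Iso (c k) (w (e' (i.1 k))))
          (Z := fun l => Iso (d l) (w (e' l))) i.1
          fun k => (Iso.congrLeft (t := c k) (s := d (i.1 k)) (i.2 k) (w (e' (i.1 k)))).symm).symm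
  | fat a, fat b, i, fat w => Iso.congrLeft (t := a) (s := b) i w
  | meagre _ _, fat _, i, _ => i.elim
  | fat _, meagre _ _, i, _ => i.elim
  | meagre _ _, meagre _ _, _, fat _ => Equiv.refl Empty
  | fat _, fat _, _, meagre _ _ => Equiv.refl Empty

/-- Composing with an isomorphism on the right is a bijection of sets of isomorphisms. -/
def Iso.congrRight : ∀ {s u : PlaneTree}, Iso s u → ∀ t : PlaneTree, Iso t s ≃ Iso t u
  | meagre _ d, meagre _ w, i, meagre _ c =>
      Equiv.sigmaCongr (Equiv.equivCongr (Equiv.refl _) i.1) fun e' =>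
        Equiv.piCongrRight fun k =>
          Iso.congrRight (s := d (e' k)) (u := w (i.1 (e' k))) (i.2 (e' k)) (c k)
  | fat a, fat b, i, fat w => Iso.congrRight (s := a) (u := b) i w
  | meagre _ _, fat _, i, _ => i.elim
  | fat _, meagre _ _, i, _ => i.elim
  | meagre _ _, meagre _ _, _, fat _ => Equiv.refl Empty
  | fat _, fat _, _, meagre _ _ => Equiv.refl Empty

theorem Iso.finite : ∀ t s : PlaneTree, Finite (Iso t s)
  | meagre n c, meagre m d => by
      have h := fun (e : Fin n ≃ Fin m) (i : Fin n) => Iso.finite (c i) (d (e i))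
      exact inferInstanceAs (Finite (Σ e : Fin n ≃ Fin m, ∀ i, Iso (c i) (d (e i))))
  | fat a, fat b => Iso.finite a b
  | meagre _ _, fat _ => inferInstanceAs (Finite Empty)
  | fat _, meagre _ _ => inferInstanceAs (Finite Empty)

/-- Two plane trees represent the same TW-tree iff they are isomorphic. -/
instance setoid : Setoid PlaneTree where
  r t s := Nonempty (Iso t s)
  iseqv :=
    { refl := fun t => ⟨Iso.refl t⟩
      symm := fun ⟨i⟩ => ⟨i.symm⟩
      trans := fun ⟨i⟩ ⟨j⟩ => ⟨i.congrLeft _ j⟩ }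

/-- The order of a tree: its number of nodes. -/
def order : PlaneTree → ℕ
  | meagre _ c => 1 + ∑ i, order (c i)
  | fat a => 1 + order a

/-- The density: the product over all vertices of the orders of the sub-trees rooted there. -/
def density : PlaneTree → ℕ
  | meagre n c => order (meagre n c) * ∏ i, density (c i)
  | fat a => order (fat a) * density a

/-- The order of the symmetry group: the number of automorphisms of the tree. -/
def symmetry (t : PlaneTree) : ℕ := Nat.card (Iso t t)

/-- The tree has no fat node. -/
def AllMeagre : PlaneTree → Prop
  | meagre _ c => ∀ i, AllMeagre (c i)
  | fat _ => False

/-- The elementary differential: a meagre node with `n` children stands for the `n`-th derivative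
of `f` at `y`, applied to the elementary differentials of the branches; a fat node stands for
multiplication by the approximate Jacobian `A`. -/
def elemDiff {N : ℕ} (f : (Fin N → ℝ) → (Fin N → ℝ)) (A : Matrix (Fin N) (Fin N) ℝ)
    (y : Fin N → ℝ) : PlaneTree → (Fin N → ℝ)
  | meagre n c => iteratedFDeriv ℝ n f y fun i => elemDiff f A y (c i)
  | fat a => A *ᵥ elemDiff f A y a

theorem order_eq_of_iso : ∀ {t s : PlaneTree}, Iso t s → order t = order s
  | meagre _ c, meagre _ d, i => by
      rw [order, order, ← Equiv.sum_comp i.1]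
      congr 1
      exact Finset.sum_congr rfl fun k _ => order_eq_of_iso (i.2 k)
  | fat a, fat b, i => by
      rw [order, order, order_eq_of_iso (t := a) (s := b) i]
  | meagre _ _, fat _, i => i.elim
  | fat _, meagre _ _, i => i.elim

theorem density_eq_of_iso : ∀ {t s : PlaneTree}, Iso t s → density t = density s
  | meagre n c, meagre m d, i => by
      rw [density, density, order_eq_of_iso (t := meagre n c) (s := meagre m d) i,
        ← Equiv.prod_comp i.1]
      congr 1
      exact Finset.prod_congr rfl fun k _ => density_eq_of_iso (i.2 k)
  | fat a, fat b, i => by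
      rw [density, density, order_eq_of_iso (t := fat a) (s := fat b) i,
        density_eq_of_iso (t := a) (s := b) i]
  | meagre _ _, fat _, i => i.elim
  | fat _, meagre _ _, i => i.elim

theorem symmetry_eq_of_iso {t s : PlaneTree} (i : Iso t s) : symmetry t = symmetry s :=
  Nat.card_congr ((i.congrRight t).trans (i.congrLeft s).symm)

theorem allMeagre_of_iso : ∀ {t s : PlaneTree}, Iso t s → AllMeagre t → AllMeagre s
  | meagre _ c, meagre _ d, i => fun h k => by
      have := allMeagre_of_iso (i.2 (i.1.symm k)) (h (i.1.symm k))
      rwa [Equiv.apply_symm_apply] at this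
  | fat _, _, _ => fun h => h.elim
  | meagre _ _, fat _, i => i.elim

/-- For smooth `f` the elementary differential does not depend on the order of the children. -/
theorem elemDiff_eq_of_iso {N : ℕ} {f : (Fin N → ℝ) → (Fin N → ℝ)} {y : Fin N → ℝ}
    (hf : ContDiffAt ℝ ∞ f y) (A : Matrix (Fin N) (Fin N) ℝ) :
    ∀ {t s : PlaneTree}, Iso t s → elemDiff f A y t = elemDiff f A y s
  | meagre n c, meagre m d, i => by
      obtain ⟨e, j⟩ := i
      obtain rfl : n = m := by simpa using Fintype.card_congr e
      have hk : (fun k => elemDiff f A y (c k)) = fun k => elemDiff f A y (d (e k)) :=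
        funext fun k => elemDiff_eq_of_iso hf A (j k)
      rw [elemDiff, elemDiff, hk]
      exact iteratedFDeriv_comp_perm n (hf.of_le (by exact_mod_cast le_top)) e
        fun k => elemDiff f A y (d k)
  | fat a, fat b, i => by
      rw [elemDiff, elemDiff, elemDiff_eq_of_iso hf A (t := a) (s := b) i]
  | meagre _ _, fat _, i => i.elim
  | fat _, meagre _ _, i => i.elim

theorem order_pos (t : PlaneTree) : 0 < order t := by
  cases t <;> rw [order] <;> omega

theorem finite_order_le (p : ℕ) : {t : PlaneTree | order t ≤ p}.Finite := by
  induction p with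
  | zero =>
      refine Set.Finite.subset Set.finite_empty fun t ht => ?_
      have := order_pos t
      simp only [Set.mem_ofPred_eq] at ht
      omega
  | succ p ih =>
      refine Set.Finite.subset
        (((Set.finite_Iic p).biUnion fun n _ =>
          (Set.Finite.pi' (fun _ : Fin n => ih)).image (meagre n)).union (ih.image fat)) ?_
      rintro (⟨n, c⟩ | a) ht
      · left
        simp only [Set.mem_ofPred_eq, order] at ht
        have hs : ∑ i, order (c i) ≤ p := by omega
        have hn : n ≤ ∑ i, order (c i) := by
          simpa using Finset.sum_le_sum (s := Finset.univ) (f := fun _ => 1)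
            (g := fun i => order (c i)) fun i _ => order_pos (c i)
        refine Set.mem_biUnion (show n ∈ Set.Iic p from hn.trans hs) ⟨c, fun i => ?_, rfl⟩
        exact (Finset.single_le_sum (fun k _ => Nat.zero_le (order (c k)))
          (Finset.mem_univ i)).trans hs
      · right
        simp only [Set.mem_ofPred_eq, order] at ht
        exact ⟨a, by simp only [Set.mem_ofPred_eq]; omega, rfl⟩

end PlaneTree

/-- TW-trees: isomorphism classes. -/
def Tree : Type := Quotient PlaneTree.setoid

namespace Tree

/-- `|τ|`, the number of nodes. -/
def order : Tree → ℕ := Quotient.lift PlaneTree.order fun _ _ ⟨i⟩ => PlaneTree.order_eq_of_iso i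

/-- `γ(τ)`. -/
def density : Tree → ℕ :=
  Quotient.lift PlaneTree.density fun _ _ ⟨i⟩ => PlaneTree.density_eq_of_iso i

/-- `σ(τ)`, the order of the symmetry group. -/
def symmetry : Tree → ℕ :=
  Quotient.lift PlaneTree.symmetry fun _ _ ⟨i⟩ => PlaneTree.symmetry_eq_of_iso i

/-- The tree has no fat node. -/
def AllMeagre : Tree → Prop :=
  Quotient.lift PlaneTree.AllMeagre fun _ _ ⟨i⟩ =>
    propext ⟨PlaneTree.allMeagre_of_iso i, PlaneTree.allMeagre_of_iso i.symm⟩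

/-- `T`, the ordinary Butcher trees, as a set of TW-trees: those without fat nodes. -/
def T : Set Tree := {τ | τ.AllMeagre}

/-- `F(τ)(y)`, computed on a plane representative of `τ`; for `f` smooth at `y` the choice is
immaterial, see `elemDiff_mk`. -/
def elemDiff {N : ℕ} (f : (Fin N → ℝ) → (Fin N → ℝ)) (A : Matrix (Fin N) (Fin N) ℝ) (τ : Tree)
    (y : Fin N → ℝ) : Fin N → ℝ :=
  PlaneTree.elemDiff f A y (Quotient.out τ)

theorem elemDiff_mk {N : ℕ} {f : (Fin N → ℝ) → (Fin N → ℝ)} {y : Fin N → ℝ}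
    (hf : ContDiffAt ℝ ∞ f y) (A : Matrix (Fin N) (Fin N) ℝ) (t : PlaneTree) :
    elemDiff f A (Quotient.mk PlaneTree.setoid t) y = PlaneTree.elemDiff f A y t := by
  obtain ⟨i⟩ := Quotient.mk_out (s := PlaneTree.setoid) t
  exact PlaneTree.elemDiff_eq_of_iso hf A i

theorem finite_order_le (p : ℕ) : {τ : Tree | order τ ≤ p}.Finite := by
  refine ((PlaneTree.finite_order_le p).image (Quotient.mk PlaneTree.setoid)).subset ?_
  intro τ
  induction τ using Quotient.inductionOn with
  | h t => exact fun ht => ⟨t, ht, rfl⟩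

end Tree

/-- The terms up to order `p` in `h` of the B-series
`B(a, y) = a(∅) y + ∑_{τ ∈ TW} a(τ) h^|τ| / σ(τ) F(τ)(y)`; the empty tree is `none`. -/
def bSeriesUpTo {N : ℕ} (f : (Fin N → ℝ) → (Fin N → ℝ)) (A : Matrix (Fin N) (Fin N) ℝ)
    (a : Option Tree → ℝ) (y : Fin N → ℝ) (p : ℕ) (h : ℝ) : Fin N → ℝ :=
  a none • y + ∑ τ ∈ (Tree.finite_order_le p).toFinset,
    (a (some τ) * (h ^ τ.order / (τ.symmetry : ℝ))) • τ.elemDiff f A y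

/-- `B(a, y₀)` is the expansion of `u(h)` in powers of `h` as `h → 0+`, to every order. -/
def HasBSeries {N : ℕ} (f : (Fin N → ℝ) → (Fin N → ℝ)) (A : Matrix (Fin N) (Fin N) ℝ)
    (a : Option Tree → ℝ) (y₀ : Fin N → ℝ) (u : ℝ → (Fin N → ℝ)) : Prop :=
  ∀ p : ℕ, (fun h : ℝ => u h - bSeriesUpTo f A a y₀ p h) =O[𝓝[>] 0] fun h : ℝ => h ^ (p + 1)

/-- `y` solves `y' = f(y)` on `[t₀, t₁]`, with one-sided derivatives at the end points. -/
def IsExactSolution {N : ℕ} (f : (Fin N → ℝ) → (Fin N → ℝ)) (t₀ t₁ : ℝ)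
    (y : ℝ → (Fin N → ℝ)) : Prop :=
  ∀ t ∈ Set.Icc t₀ t₁, HasDerivWithinAt y (f (y t)) (Set.Icc t₀ t₁) t

/-- `a` is a system of B-series coefficients over TW-trees of the exact solution at the next step:
for every initial value problem `y' = f(y)`, `y(tₙ) = yₙ` in every `ℝ^N` with `f` smooth at `yₙ`,
and every matrix `A` in the role of the approximate Jacobian, `y(tₙ + h)` has the expansion
`B(a, yₙ)`. -/
def IsExactSolutionCoeff (a : Option Tree → ℝ) : Prop :=
  ∀ (N : ℕ) (f : (Fin N → ℝ) → (Fin N → ℝ)) (A : Matrix (Fin N) (Fin N) ℝ)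
    (y : ℝ → (Fin N → ℝ)) (yₙ : Fin N → ℝ) (tₙ t₁ : ℝ), tₙ < t₁ → y tₙ = yₙ →
    ContDiffAt ℝ ∞ f yₙ → IsExactSolution f tₙ t₁ y →
    HasBSeries f A a yₙ fun h => y (tₙ + h)

end TW

end

/-! Existence is a bootstrap on the integral form of y' = f(y). Let Z_p be the candidate series
without its constant term, cut off at order p. Taylor's formula for f at y, with Z_p substituted and
multilinearity used, turns f(y + Z_p) into a sum over families of branches, that is, over trees with
a meagre root. Differentiating h^|τ| gives |τ| h^(|τ|-1), and the factor |τ| cancels the root's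
contribution to 1/γ(τ); so Z_{p+1}' agrees with f(y + Z_p) up to O(h^(p+1)). Since f is Lipschitz
near y, an error O(h^(p+1)) in the solution gives the same error in its derivative, and integration
gains one power of h. Fat nodes never arise, hence the coefficient 0. Multilinear expansion produces
ordered branches, so this is carried out on plane trees. Each plane tree has the weight ∏ 1/n!, over
its meagre vertices with n children; the weights of the plane representatives of τ add up to 1/σ(τ)
(`sum_weight_mul_card_iso`, `sum_tree_eq_sum_upTo`). Uniqueness needs elementary differentials that
are separated by coordinates. Take one coordinate for each tree of order at most p. The component of
f at a tree with meagre root is the monomial in the coordinates of its branches, and A sends the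
basis vector of a tree to that of the tree with a fat root added. At the origin F(τ) is then a
positive multiple of the basis vector of τ (`elemDiff_treeField`), so a single coordinate reads off
a(τ). -/

namespace TW

/-! ### Weighted sums over plane trees and the symmetry factor. -/

namespace PlaneTree

/-- The plane trees of order at most `p`. -/
noncomputable def upTo (p : ℕ) : Finset PlaneTree := (finite_order_le p).toFinset

theorem mem_upTo {p : ℕ} {t : PlaneTree} : t ∈ upTo p ↔ order t ≤ p := by
  simp [upTo]

theorem upTo_zero : upTo 0 = ∅ := by
  ext t
  simpa [mem_upTo] using (order_pos t).ne'

theorem order_meagre (n : ℕ) (c : Fin n → PlaneTree) :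
    order (meagre n c) = 1 + ∑ i, order (c i) := by rw [order]

theorem order_fat (a : PlaneTree) : order (fat a) = 1 + order a := by rw [order]

theorem arity_le_sum_order {n : ℕ} (c : Fin n → PlaneTree) : n ≤ ∑ i, order (c i) := by
  simpa using Finset.sum_le_sum (s := Finset.univ) (f := fun _ => 1)
    (g := fun i => order (c i)) fun i _ => order_pos (c i)

/-- The families of `n` branches with at most `p` nodes altogether. -/
noncomputable def branches (p n : ℕ) : Finset (Fin n → PlaneTree) :=
  (Fintype.piFinset fun _ => upTo p).filter fun c => ∑ i, order (c i) ≤ p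

theorem mem_branches {p n : ℕ} {c : Fin n → PlaneTree} :
    c ∈ branches p n ↔ ∑ i, order (c i) ≤ p := by
  simp only [branches, Finset.mem_filter, Fintype.mem_piFinset, mem_upTo, and_iff_right_iff_imp]
  exact fun h i => (Finset.single_le_sum (fun k _ => Nat.zero_le (order (c k)))
    (Finset.mem_univ i)).trans h

/-- Cutting off the root is the recursion behind all the tree sums. Every branch has a node, so the
arity of the root is at most `p` and finitely many `n` suffice. -/
theorem sum_upTo_succ {M : Type*} [AddCommMonoid M] (G : PlaneTree → M) (p : ℕ) :
    ∑ t ∈ upTo (p + 1), G t =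
      ∑ n ∈ Finset.range (p + 1), ∑ c ∈ branches p n, G (meagre n c) +
        ∑ a ∈ upTo p, G (fat a) := by
  classical
  rw [Finset.sum_sigma']
  have hm : Set.InjOn (fun x : (n : ℕ) × (Fin n → PlaneTree) => meagre x.1 x.2)
      ((Finset.range (p + 1)).sigma (branches p)) := by
    rintro ⟨n, c⟩ - ⟨m, d⟩ - h
    cases h
    rfl
  have hf : Set.InjOn fat (upTo p : Set PlaneTree) := fun a _ b _ h => fat.inj h
  rw [← Finset.sum_image (f := G) hm, ← Finset.sum_image (f := G) hf, ← Finset.sum_union]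
  · congr 1
    ext t
    simp only [mem_upTo, Finset.mem_union, Finset.mem_image, Finset.mem_sigma, Finset.mem_range,
      mem_branches, Sigma.exists]
    cases t with
    | meagre n c =>
      have := arity_le_sum_order c
      rw [order_meagre]
      constructor
      · exact fun h => Or.inl ⟨n, c, ⟨by omega, by omega⟩, rfl⟩
      · rintro (⟨m, d, ⟨-, h⟩, e⟩ | ⟨a, -, e⟩)
        · obtain ⟨rfl, e⟩ := meagre.inj e
          rw [← eq_of_heq e]; omega
        · cases e
    | fat a =>
      rw [order_fat]
      constructor
      · exact fun h => Or.inr ⟨a, by omega, rfl⟩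
      · rintro (⟨m, d, ⟨-, h⟩, e⟩ | ⟨b, h, e⟩)
        · cases e
        · rw [← fat.inj e]; omega
  · rw [Finset.disjoint_left]
    intro t ht ht'
    simp only [Finset.mem_image] at ht ht'
    obtain ⟨x, -, rfl⟩ := ht
    obtain ⟨a, -, h⟩ := ht'
    cases h

/-- The share of a plane tree in the reciprocal of the symmetry of the tree it represents. -/
noncomputable def weight : PlaneTree → ℝ
  | meagre n c => (n.factorial : ℝ)⁻¹ * ∏ i, weight (c i)
  | fat a => weight a

theorem card_iso_meagre {n : ℕ} (c d : Fin n → PlaneTree) :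
    Nat.card (Iso (meagre n c) (meagre n d)) =
      ∑ e : Equiv.Perm (Fin n), ∏ i, Nat.card (Iso (c i) (d (e i))) := by
  have h : ∀ t s, Finite (Iso t s) := Iso.finite
  change Nat.card (Σ e : Fin n ≃ Fin n, ∀ i, Iso (c i) (d (e i))) = _
  rw [Nat.card_sigma]
  exact Finset.sum_congr rfl fun e _ => Nat.card_pi

theorem card_iso_eq_zero {t s : PlaneTree} (h : order t ≠ order s) : Nat.card (Iso t s) = 0 := by
  have : IsEmpty (Iso t s) := ⟨fun i => h (order_eq_of_iso i)⟩
  exact Nat.card_of_isEmpty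

theorem card_iso_meagre_of_ne {n m : ℕ} (h : n ≠ m) (c : Fin n → PlaneTree)
    (d : Fin m → PlaneTree) : Nat.card (Iso (meagre n c) (meagre m d)) = 0 := by
  have : IsEmpty (Iso (meagre n c) (meagre m d)) :=
    ⟨fun i => h (by simpa using Fintype.card_congr i.1)⟩
  exact Nat.card_of_isEmpty

/-- The weights of the plane representatives of a tree, each counted with the number of its
isomorphisms to a fixed representative, sum to one. -/
theorem sum_weight_mul_card_iso (p : ℕ) : ∀ t : PlaneTree, order t ≤ p →
    ∑ s ∈ upTo p, weight s * Nat.card (Iso s t) = 1 := by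
  induction p with
  | zero => intro t ht; have := order_pos t; omega
  | succ p ih =>
    rintro (⟨n, d⟩ | b) ht
    · rw [order_meagre] at ht
      have hn := arity_le_sum_order d
      have hfat : ∀ a, Nat.card (Iso (fat a) (meagre n d)) = 0 := fun a =>
        inferInstanceAs (IsEmpty Empty) |> fun (_ : IsEmpty (Iso (fat a) (meagre n d))) =>
          Nat.card_of_isEmpty
      rw [sum_upTo_succ, Finset.sum_eq_single_of_mem n (Finset.mem_range.2 (by omega))]
      · simp only [hfat, Nat.cast_zero, mul_zero, Finset.sum_const_zero, add_zero]
        have hsub : branches p n ⊆ Fintype.piFinset fun _ => upTo p := Finset.filter_subset _ _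
        -- Dropping the bound on the total order turns the index set into a product; the added
        -- families have the wrong order, hence no isomorphism to `d`.
        rw [Finset.sum_subset hsub]
        · have hd : ∀ i, order (d i) ≤ p := fun i =>
            (Finset.single_le_sum (fun k _ => Nat.zero_le (order (d k)))
              (Finset.mem_univ i)).trans (by omega)
          -- For a fixed matching of the branches the sum factors into one sum per branch, each
          -- equal to 1 by induction. The `n!` matchings then cancel the factor `1 / n!` of
          -- `weight`.
          have key : ∀ e : Equiv.Perm (Fin n),
              ∑ c ∈ Fintype.piFinset fun _ : Fin n => upTo p,
                ∏ i, weight (c i) * (Nat.card (Iso (c i) (d (e i))) : ℝ) = 1 := by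
            intro e
            rw [Finset.sum_prod_piFinset (upTo p)
              fun i s => weight s * (Nat.card (Iso s (d (e i))) : ℝ)]
            exact Finset.prod_eq_one fun i _ => ih _ (hd _)
          have h : ∀ c : Fin n → PlaneTree,
              weight (meagre n c) * (Nat.card (Iso (meagre n c) (meagre n d)) : ℝ) =
              (n.factorial : ℝ)⁻¹ * ∑ e : Equiv.Perm (Fin n),
                ∏ i, weight (c i) * (Nat.card (Iso (c i) (d (e i))) : ℝ) := by
            intro c
            rw [card_iso_meagre, weight]
            push_cast
            simp only [mul_assoc, Finset.prod_mul_distrib, Finset.mul_sum]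
          simp only [h]
          rw [← Finset.mul_sum, Finset.sum_comm]
          simp only [key]
          have : (n.factorial : ℝ) ≠ 0 := by positivity
          simp [Fintype.card_perm, this]
        · intro c _ hc
          rw [mem_branches] at hc
          rw [card_iso_eq_zero, Nat.cast_zero, mul_zero]
          rw [order_meagre, order_meagre]
          omega
      · intro m _ hm
        refine Finset.sum_eq_zero fun c _ => ?_
        rw [card_iso_meagre_of_ne hm, Nat.cast_zero, mul_zero]
    · rw [order_fat] at ht
      have hmeagre : ∀ n c, Nat.card (Iso (meagre n c) (fat b)) = 0 := fun n c =>
        inferInstanceAs (IsEmpty Empty) |> fun (_ : IsEmpty (Iso (meagre n c) (fat b))) =>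
          Nat.card_of_isEmpty
      rw [sum_upTo_succ]
      simp only [hmeagre, Nat.cast_zero, mul_zero, Finset.sum_const_zero, zero_add]
      exact ih b (by omega)

theorem symmetry_ne_zero (t : PlaneTree) : symmetry t ≠ 0 := by
  have : Finite (Iso t t) := Iso.finite t t
  have : Nonempty (Iso t t) := ⟨Iso.refl t⟩
  exact Nat.card_pos.ne'

/-- A sum over trees weighted by reciprocal symmetries, as a sum over plane trees. -/
theorem sum_tree_eq_sum_upTo {E : Type*} [AddCommGroup E] [Module ℝ E] (G : Tree → E) (p : ℕ) :
    ∑ τ ∈ (Tree.finite_order_le p).toFinset, (τ.symmetry : ℝ)⁻¹ • G τ =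
      ∑ t ∈ upTo p, weight t • G (Quotient.mk setoid t) := by
  classical
  rw [← Finset.sum_fiberwise_of_maps_to (s := upTo p) (t := (Tree.finite_order_le p).toFinset)
    (g := Quotient.mk setoid)
    (fun t ht => (Set.Finite.mem_toFinset _).2 (mem_upTo.1 ht : order t ≤ p))]
  refine Finset.sum_congr rfl fun τ hτ => ?_
  induction τ using Quotient.inductionOn with
  | h s =>
    have hs : order s ≤ p := (Set.Finite.mem_toFinset (Tree.finite_order_le p)).1 hτ
    have h1 := sum_weight_mul_card_iso p s hs
    -- A plane tree in the class of `s` has `symmetry s` isomorphisms to `s`, any other has none; so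
    -- `h1` says that the total weight of the class times `symmetry s` is 1.
    have h2 : ∑ t ∈ upTo p with Quotient.mk setoid t = Quotient.mk setoid s, weight t
        = (symmetry s : ℝ)⁻¹ := by
      rw [← mul_eq_one_iff_eq_inv₀ (Nat.cast_ne_zero.2 (symmetry_ne_zero s)), ← h1,
        Finset.sum_filter, Finset.sum_mul]
      refine Finset.sum_congr rfl fun t _ => ?_
      split_ifs with h
      · obtain ⟨i⟩ := Quotient.exact h
        rw [symmetry, Nat.card_congr (Iso.congrLeft i s)]
      · have : IsEmpty (Iso t s) := ⟨fun i => h (Quotient.sound ⟨i⟩)⟩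
        rw [zero_mul, Nat.card_of_isEmpty, Nat.cast_zero, mul_zero]
    rw [show (Tree.symmetry (Quotient.mk setoid s) : ℝ) = symmetry s from rfl, ← h2,
      Finset.sum_smul]
    refine Finset.sum_congr (by congr!) fun t ht => ?_
    rw [(Finset.mem_filter.1 ht).2]

/-- The B-series coefficient of the exact solution, by recursion on plane trees. -/
noncomputable def exactCoeff : PlaneTree → ℝ
  | meagre n c => (order (meagre n c) : ℝ)⁻¹ * ∏ i, exactCoeff (c i)
  | fat _ => 0

theorem exactCoeff_of_allMeagre : ∀ {t : PlaneTree}, AllMeagre t →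
    exactCoeff t = 1 / (density t : ℝ)
  | meagre n c, h => by
      rw [exactCoeff, density, Finset.prod_congr rfl fun i _ => exactCoeff_of_allMeagre (h i)]
      push_cast
      simp [mul_comm]
  | fat _, h => h.elim

theorem exactCoeff_of_not_allMeagre : ∀ {t : PlaneTree}, ¬ AllMeagre t → exactCoeff t = 0
  | meagre n c, h => by
      rw [AllMeagre, not_forall] at h
      obtain ⟨i, hi⟩ := h
      rw [exactCoeff, Finset.prod_eq_zero (Finset.mem_univ i) (exactCoeff_of_not_allMeagre hi),
        mul_zero]
  | fat _, _ => by rw [exactCoeff]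

end PlaneTree

end TW

/-! ### Asymptotic estimates: integration of O-bounds and Taylor's formula. -/

namespace TW

open Asymptotics Set

theorem isBigO_pow_nhdsGE {a b : ℕ} (h : b ≤ a) :
    (fun x : ℝ => x ^ a) =O[𝓝[≥] 0] fun x => x ^ b := by
  refine IsBigO.of_bound 1 ?_
  filter_upwards [Icc_mem_nhdsGE (zero_lt_one (α := ℝ))] with x hx
  rw [one_mul, Real.norm_of_nonneg (pow_nonneg hx.1 _), Real.norm_of_nonneg (pow_nonneg hx.1 _)]
  exact pow_le_pow_of_le_one hx.1 hx.2 h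

/-- A bound on the order of vanishing at the left end point may be integrated. -/
theorem isBigO_pow_succ_of_hasDerivWithinAt {E : Type*} [NormedAddCommGroup E] [NormedSpace ℝ E]
    {D D' : ℝ → E} {δ : ℝ} (hδ : 0 < δ)
    (hD : ∀ x ∈ Icc 0 δ, HasDerivWithinAt D (D' x) (Icc 0 δ) x) (h0 : D 0 = 0) {k : ℕ}
    (hO : D' =O[𝓝[≥] 0] fun x => x ^ k) : D =O[𝓝[≥] 0] fun x => x ^ (k + 1) := by
  obtain ⟨C, hC0, hC⟩ := hO.exists_nonneg
  obtain ⟨ε, hε, hs⟩ := mem_nhdsGE_iff_exists_Icc_subset.1 hC.bound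
  refine IsBigO.of_bound C ?_
  filter_upwards [Icc_mem_nhdsGE (lt_min hδ hε)] with x hx
  have hxδ : x ≤ δ := hx.2.trans (min_le_left _ _)
  have hxε : x ≤ ε := hx.2.trans (min_le_right _ _)
  -- On `[0, x]` the constant `C * x ^ k` dominates the derivative, so the mean value inequality
  -- suffices and no integral is needed.
  have := norm_image_sub_le_of_norm_deriv_le_segment' (f := D) (f' := D') (C := C * x ^ k)
    (a := 0) (b := x)
    (fun y hy => (hD y ⟨hy.1, hy.2.trans hxδ⟩).mono (Icc_subset_Icc_right hxδ))
    (fun y hy => by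
      have h1 : ‖D' y‖ ≤ C * ‖y ^ k‖ := hs ⟨hy.1, hy.2.le.trans hxε⟩
      rw [Real.norm_of_nonneg (pow_nonneg hy.1 _)] at h1
      exact h1.trans (mul_le_mul_of_nonneg_left (pow_le_pow_left₀ hy.1 hy.2.le k) hC0))
    x (right_mem_Icc.2 hx.1)
  rw [h0, sub_zero, sub_zero] at this
  rwa [Real.norm_of_nonneg (pow_nonneg hx.1 _), pow_succ, ← mul_assoc]

/-- Taylor's formula for a function on a normed space, with remainder `O(‖z‖ ^ (p + 1))`. -/
theorem taylor_isBigO {E F : Type*} [NormedAddCommGroup E] [NormedSpace ℝ E]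
    [NormedAddCommGroup F] [NormedSpace ℝ F] [CompleteSpace F] {f : E → F} {x : E} {p : ℕ}
    (hf : ContDiffAt ℝ (p + 1 : ℕ) f x) :
    (fun z => f (x + z) - ∑ n ∈ Finset.range (p + 1),
      (n.factorial : ℝ)⁻¹ • iteratedFDeriv ℝ n f x fun _ => z) =O[𝓝 0]
      fun z => ‖z‖ ^ (p + 1) := by
  have hcont : ContinuousAt (iteratedFDeriv ℝ (p + 1) f) x :=
    hf.continuousAt_iteratedFDeriv le_rfl
  have hev : ∀ᶠ x' in 𝓝 x, ContDiffAt ℝ (p + 1 : ℕ) f x' ∧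
      ‖iteratedFDeriv ℝ (p + 1) f x'‖ < ‖iteratedFDeriv ℝ (p + 1) f x‖ + 1 :=
    (hf.eventually (by simp)).and (hcont.norm.eventually (gt_mem_nhds (lt_add_one _)))
  obtain ⟨r, hr, hball⟩ := Metric.eventually_nhds_iff_ball.1 hev
  set C := ‖iteratedFDeriv ℝ (p + 1) f x‖ + 1
  refine IsBigO.of_bound ((p.factorial : ℝ)⁻¹ * C) ?_
  filter_upwards [Metric.ball_mem_nhds (0 : E) hr] with z hz
  have hmem : ∀ t ∈ Icc (0 : ℝ) 1, x + t • z ∈ Metric.ball x r := by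
    intro t ht
    rw [mem_ball_iff_norm, add_sub_cancel_left, norm_smul, Real.norm_of_nonneg ht.1]
    rw [mem_ball_zero_iff] at hz
    exact (mul_le_of_le_one_left (norm_nonneg _) ht.2).trans_lt hz
  -- The integral form of the remainder; on the ball the derivative of order `p + 1` is bounded by
  -- `C`.
  rw [map_add_eq_sum_add_integral_iteratedFDeriv (n := p) (f := f) (x := x) (y := z)
    (fun t ht => by exact_mod_cast (hball _ (hmem t ht)).1), add_sub_cancel_left, norm_smul,
    Real.norm_of_nonneg (by positivity : (0 : ℝ) ≤ (p.factorial : ℝ)⁻¹), mul_assoc]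
  gcongr
  rw [norm_pow, norm_norm]
  have := intervalIntegral.norm_integral_le_of_norm_le_const (a := (0 : ℝ)) (b := 1)
    (C := C * ‖z‖ ^ (p + 1))
    (f := fun t => (1 - t) ^ p • iteratedFDeriv ℝ (p + 1) f (x + t • z) fun _ => z) ?_
  · simpa using this
  · intro t ht
    rw [uIoc_of_le zero_le_one] at ht
    have ht' : t ∈ Icc (0 : ℝ) 1 := ⟨ht.1.le, ht.2⟩
    rw [norm_smul, norm_pow, Real.norm_of_nonneg (sub_nonneg.2 ht.2)]
    have h1 : (1 - t) ^ p ≤ 1 := pow_le_one₀ (sub_nonneg.2 ht.2) (by linarith [ht.1])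
    have h2 := (iteratedFDeriv ℝ (p + 1) f (x + t • z)).le_opNorm fun _ => z
    rw [Finset.prod_const, Finset.card_univ, Fintype.card_fin] at h2
    calc (1 - t) ^ p * _ ≤ 1 * (‖iteratedFDeriv ℝ (p + 1) f (x + t • z)‖ * ‖z‖ ^ (p + 1)) := by
          gcongr
      _ ≤ C * ‖z‖ ^ (p + 1) := by
          rw [one_mul]
          gcongr
          exact (hball _ (hmem t ht')).2.le

/-! ### Expansion of the exact solution. -/

namespace PlaneTree

variable {N : ℕ}

/-- The non-constant part, up to order `p`, of the B-series of the exact solution, as a sum over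
plane trees. -/
noncomputable def exactIncrement (f : (Fin N → ℝ) → (Fin N → ℝ)) (A : Matrix (Fin N) (Fin N) ℝ)
    (y : Fin N → ℝ) (p : ℕ) (h : ℝ) : Fin N → ℝ :=
  ∑ t ∈ upTo p, (weight t * exactCoeff t * h ^ order t) • elemDiff f A y t

/-- The term that a family of branches contributes to the Taylor expansion of `f`. -/
noncomputable def branchTerm (f : (Fin N → ℝ) → (Fin N → ℝ)) (A : Matrix (Fin N) (Fin N) ℝ)
    (y : Fin N → ℝ) (h : ℝ) {n : ℕ} (c : Fin n → PlaneTree) : Fin N → ℝ :=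
  ((n.factorial : ℝ)⁻¹ * ((∏ i, weight (c i) * exactCoeff (c i)) * h ^ ∑ i, order (c i))) •
    iteratedFDeriv ℝ n f y fun i => elemDiff f A y (c i)

variable (f : (Fin N → ℝ) → (Fin N → ℝ)) (A : Matrix (Fin N) (Fin N) ℝ) (y : Fin N → ℝ)

/-- Multilinearity: each of the `n` slots chooses a tree independently, which makes a family of
branches. -/
theorem iteratedFDeriv_exactIncrement (p n : ℕ) (h : ℝ) :
    ((n.factorial : ℝ)⁻¹ • iteratedFDeriv ℝ n f y fun _ => exactIncrement f A y p h) =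
      ∑ c ∈ Fintype.piFinset fun _ : Fin n => upTo p, branchTerm f A y h c := by
  classical
  have := (iteratedFDeriv ℝ n f y).toMultilinearMap.map_sum_finset
    (fun (_ : Fin n) t => (weight t * exactCoeff t * h ^ order t) • elemDiff f A y t)
    (fun _ => upTo p)
  simp only [ContinuousMultilinearMap.coe_coe] at this
  rw [show (fun _ : Fin n => exactIncrement f A y p h) = fun _ : Fin n => ∑ t ∈ upTo p,
    (weight t * exactCoeff t * h ^ order t) • elemDiff f A y t from rfl, this, Finset.smul_sum]
  refine Finset.sum_congr rfl fun c _ => ?_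
  rw [ContinuousMultilinearMap.map_smul_univ, smul_smul, branchTerm, Finset.prod_mul_distrib,
    Finset.prod_pow_eq_pow_sum]

/-- The factor `order t` from differentiation cancels the root factor of `exactCoeff`, and the
lowered exponent is the total order of the branches. Trees with a fat root have coefficient 0 and
drop out. -/
theorem hasDerivAt_exactIncrement (p : ℕ) (h : ℝ) :
    HasDerivAt (exactIncrement f A y (p + 1))
      (∑ n ∈ Finset.range (p + 1), ∑ c ∈ branches p n, branchTerm f A y h c) h := by
  have hd : HasDerivAt (exactIncrement f A y (p + 1))
      (∑ t ∈ upTo (p + 1), (weight t * exactCoeff t * (order t * h ^ (order t - 1))) •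
        elemDiff f A y t) h :=
    HasDerivAt.fun_sum fun t _ => ((hasDerivAt_pow (order t) h).const_mul _).smul_const _
  rw [sum_upTo_succ] at hd
  simp only [exactCoeff, mul_zero, zero_mul, zero_smul, Finset.sum_const_zero, add_zero] at hd
  convert hd using 1
  refine Finset.sum_congr rfl fun n _ => Finset.sum_congr rfl fun c _ => ?_
  have h0 : (order (meagre n c) : ℝ) ≠ 0 := Nat.cast_ne_zero.2 (order_pos _).ne'
  rw [branchTerm, elemDiff, weight, Finset.prod_mul_distrib]
  congr 1
  rw [show order (meagre n c) - 1 = ∑ i, order (c i) by rw [order_meagre]; omega]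
  field_simp

theorem exactIncrement_isBigO (p : ℕ) :
    exactIncrement f A y p =O[𝓝[≥] 0] fun h : ℝ => h := by
  unfold exactIncrement
  refine IsBigO.fun_sum fun t _ => ?_
  refine IsBigO.trans (g := fun h : ℝ => h ^ order t) ?_
    (by simpa using isBigO_pow_nhdsGE (order_pos t))
  refine IsBigO.of_bound (‖weight t * exactCoeff t‖ * ‖elemDiff f A y t‖)
    (Filter.Eventually.of_forall fun h => le_of_eq ?_)
  rw [norm_smul, norm_mul (weight t * exactCoeff t)]
  ring

theorem branchTerm_isBigO {n p : ℕ} (c : Fin n → PlaneTree) (hc : p ≤ ∑ i, order (c i)) :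
    (fun h => branchTerm f A y h c) =O[𝓝[≥] 0] fun h : ℝ => h ^ p := by
  refine IsBigO.trans (g := fun h : ℝ => h ^ ∑ i, order (c i)) ?_ (isBigO_pow_nhdsGE hc)
  refine IsBigO.of_bound (‖(n.factorial : ℝ)⁻¹ * ∏ i, weight (c i) * exactCoeff (c i)‖ *
    ‖iteratedFDeriv ℝ n f y fun i => elemDiff f A y (c i)‖)
    (Filter.Eventually.of_forall fun h => le_of_eq ?_)
  rw [branchTerm, norm_smul, ← mul_assoc, norm_mul _ (h ^ _)]
  ring

variable {f y}

/-- Substituting the increment of order `p` into `f` gives the derivative of the increment of order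
`p + 1`, up to `O(h ^ (p + 1))`. -/
theorem apply_exactIncrement_isBigO (hf : ContDiffAt ℝ ∞ f y) (p : ℕ) :
    (fun h => f (y + exactIncrement f A y p h) -
      ∑ n ∈ Finset.range (p + 1), ∑ c ∈ branches p n, branchTerm f A y h c) =O[𝓝[≥] 0]
      fun h : ℝ => h ^ (p + 1) := by
  classical
  have hZ := exactIncrement_isBigO f A y p
  have hZ0 : Filter.Tendsto (exactIncrement f A y p) (𝓝[≥] 0) (𝓝 0) :=
    hZ.trans_tendsto (tendsto_nhdsWithin_of_tendsto_nhds Filter.tendsto_id)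
  have hT := (taylor_isBigO (p := p) (hf.of_le (by exact_mod_cast le_top))).comp_tendsto hZ0
  have hT' := hT.trans (hZ.norm_left.pow (p + 1))
  -- Taylor substitution also yields families with more than `p` nodes in total; these are absorbed
  -- in the error.
  have hB : (fun h => ∑ n ∈ Finset.range (p + 1),
      ∑ c ∈ (Fintype.piFinset fun _ : Fin n => upTo p) \ branches p n, branchTerm f A y h c)
      =O[𝓝[≥] 0] fun h : ℝ => h ^ (p + 1) := by
    refine IsBigO.fun_sum fun n _ => IsBigO.fun_sum fun c hc => branchTerm_isBigO f A y c ?_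
    rw [Finset.mem_sdiff, mem_branches] at hc
    omega
  refine (hT'.add hB).congr_left fun h => ?_
  simp only [Function.comp_apply, iteratedFDeriv_exactIncrement]
  rw [sub_add, ← Finset.sum_sub_distrib]
  congr 1
  refine Finset.sum_congr rfl fun n _ => ?_
  rw [sub_eq_iff_eq_add, add_comm]
  exact (Finset.sum_sdiff (Finset.filter_subset _ _)).symm

theorem exactIncrement_zero_right (p : ℕ) : exactIncrement f A y p 0 = 0 :=
  Finset.sum_eq_zero fun t _ => by
    rw [zero_pow (order_pos t).ne', mul_zero, zero_smul]

/-- The exact solution is expanded by `exactIncrement` to every order. -/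
theorem solution_sub_exactIncrement_isBigO (hf : ContDiffAt ℝ ∞ f y) {u : ℝ → (Fin N → ℝ)}
    {δ : ℝ} (hδ : 0 < δ) (hu0 : u 0 = y)
    (hu : ∀ t ∈ Icc 0 δ, HasDerivWithinAt u (f (u t)) (Icc 0 δ) t) (p : ℕ) :
    (fun h => u h - (y + exactIncrement f A y p h)) =O[𝓝[≥] 0] fun h : ℝ => h ^ (p + 1) := by
  have hcont : Filter.Tendsto u (𝓝[≥] 0) (𝓝 y) := by
    have := (hu 0 (left_mem_Icc.2 hδ.le)).continuousWithinAt
    rw [ContinuousWithinAt, hu0, nhdsWithin_Icc_eq_nhdsGE hδ] at this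
    exact this
  induction p with
  | zero =>
    -- There is no tree of order 0, so the claim is `u h - y = O(h)`, which follows from
    -- differentiability at 0.
    have h1 := (hu 0 (left_mem_Icc.2 hδ.le)).hasFDerivWithinAt.isBigO_sub
    rw [nhdsWithin_Icc_eq_nhdsGE hδ, hu0] at h1
    simpa [exactIncrement, upTo_zero] using h1
  | succ p ih =>
    have hZ0 : Filter.Tendsto (fun h => y + exactIncrement f A y p h) (𝓝[≥] 0) (𝓝 y) := by
      have : Filter.Tendsto (exactIncrement f A y p) (𝓝[≥] 0) (𝓝 0) :=
        (exactIncrement_isBigO f A y p).trans_tendsto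
          (tendsto_nhdsWithin_of_tendsto_nhds Filter.tendsto_id)
      simpa using this.const_add y
    have hstrict : HasStrictFDerivAt f (fderiv ℝ f y) y :=
      hf.hasStrictFDerivAt (by simp)
    -- Strict differentiability makes `f` Lipschitz near `y`, so the error of order `p` passes
    -- through `f` without loss.
    have hL := (hstrict.isBigO_sub.comp_tendsto (hcont.prodMk_nhds hZ0)).trans ih
    refine isBigO_pow_succ_of_hasDerivWithinAt hδ
      (D' := fun h => f (u h) -
        ∑ n ∈ Finset.range (p + 1), ∑ c ∈ branches p n, branchTerm f A y h c)
      (fun t ht => (hu t ht).sub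
        ((hasDerivAt_exactIncrement f A y p t).const_add y).hasDerivWithinAt) ?_ ?_
    · rw [Pi.sub_apply, exactIncrement_zero_right, hu0, add_zero, sub_self]
    · refine (hL.add (apply_exactIncrement_isBigO A hf p)).congr_left fun h => ?_
      simp

end PlaneTree

/-- The coefficients `1 / γ` on trees without fat nodes and `0` elsewhere expand the exact
solution. -/
theorem isExactSolutionCoeff_of_eq {a : Option Tree → ℝ} (h0 : a none = 1)
    (hfat : ∀ τ : Tree, τ ∉ Tree.T → a (some τ) = 0)
    (hT : ∀ τ : Tree, τ ∈ Tree.T → a (some τ) = 1 / (τ.density : ℝ)) :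
    IsExactSolutionCoeff a := by
  intro N f A y yₙ tₙ t₁ ht hy hf hsol p
  have ha : ∀ t : PlaneTree, a (some (Quotient.mk PlaneTree.setoid t)) = t.exactCoeff := by
    intro t
    by_cases h : t.AllMeagre
    · rw [PlaneTree.exactCoeff_of_allMeagre h]
      exact hT (Quotient.mk PlaneTree.setoid t) h
    · rw [PlaneTree.exactCoeff_of_not_allMeagre h]
      exact hfat (Quotient.mk PlaneTree.setoid t) h
  have hB : ∀ h, bSeriesUpTo f A a yₙ p h = yₙ + PlaneTree.exactIncrement f A yₙ p h := by
    intro h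
    rw [bSeriesUpTo, h0, one_smul, PlaneTree.exactIncrement]
    congr 1
    have := PlaneTree.sum_tree_eq_sum_upTo
      (fun τ => (a (some τ) * h ^ τ.order) • τ.elemDiff f A yₙ) p
    simp only [Tree.elemDiff_mk hf, ha, smul_smul] at this
    refine Eq.trans (Finset.sum_congr rfl fun τ _ => ?_) (this.trans
      (Finset.sum_congr rfl fun t _ => ?_))
    · congr 1
      ring
    · rw [mul_assoc]
      rfl
  simp only [hB]
  refine (PlaneTree.solution_sub_exactIncrement_isBigO A hf (sub_pos.2 ht) (by simpa using hy)
    (fun t h => ?_) p).mono (nhdsWithin_mono _ Ioi_subset_Ici_self)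
  have h' : tₙ + t ∈ Icc tₙ t₁ := ⟨by linarith [h.1], by linarith [h.2]⟩
  have hmaps : MapsTo (fun s : ℝ => tₙ + s) (Icc 0 (t₁ - tₙ)) (Icc tₙ t₁) :=
    fun s hs => ⟨by linarith [hs.1], by linarith [hs.2]⟩
  have := (hsol _ h').scomp t ((hasDerivAt_id t).const_add tₙ).hasDerivWithinAt hmaps
  rw [one_smul] at this
  exact this

end TW

/-! ### A vector field and a matrix that separate the trees. -/

namespace TW

open Asymptotics Set

/-- The product of the coordinates `k i`, as a multilinear map. -/
noncomputable def coordProd {N n : ℕ} (k : Fin n → Fin N) :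
    ContinuousMultilinearMap ℝ (fun _ : Fin n => Fin N → ℝ) ℝ :=
  (ContinuousMultilinearMap.mkPiAlgebra ℝ (Fin n) ℝ).compContinuousLinearMap
    fun i => ContinuousLinearMap.proj (k i)

theorem coordProd_apply {N n : ℕ} (k : Fin n → Fin N) (v : Fin n → Fin N → ℝ) :
    coordProd k v = ∏ i, v i (k i) := by
  simp [coordProd]

/-- A monomial is `coordProd k` on the diagonal, so its derivative of full degree is the
symmetrisation of that multilinear map. -/
theorem iteratedFDeriv_coordProd {N n : ℕ} (k : Fin n → Fin N) (x : Fin N → ℝ)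
    (v : Fin n → Fin N → ℝ) :
    iteratedFDeriv ℝ n (fun y : Fin N → ℝ => ∏ i, y (k i)) x v =
      ∑ σ : Equiv.Perm (Fin n), ∏ i, v (σ i) (k i) := by
  simpa only [coordProd_apply] using (coordProd k).iteratedFDeriv_comp_diagonal x v

/-- Derivatives at the origin of a monomial, of an order other than its degree, vanish. -/
theorem iteratedFDeriv_coordProd_of_ne {N n m : ℕ} (h : m ≠ n) (k : Fin n → Fin N)
    (v : Fin m → Fin N → ℝ) :
    iteratedFDeriv ℝ m (fun y : Fin N → ℝ => ∏ i, y (k i)) 0 v = 0 := by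
  -- The power series of the monomial at 0 lives in degree `n` only; the derivative of order `m`
  -- symmetrises its term of degree `m`, which is 0.
  let q : FormalMultilinearSeries ℝ (Fin N → ℝ) ℝ :=
    fun j => if h : n = j then h ▸ coordProd k else 0
  have A : HasFiniteFPowerSeriesOnBall (fun y : Fin N → ℝ => ∏ i, y (k i)) q 0 (n + 1) ⊤ := by
    apply HasFiniteFPowerSeriesOnBall.mk' _ (by simp)
    · intro y _
      rw [Finset.sum_eq_single_of_mem n (by simp)]
      · simp [q, coordProd_apply]
      · intro i _ hi
        simp [q, hi.symm]
    · intro j hj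
      have : n ≠ j := by omega
      simp [q, this]
  rw [A.toHasFPowerSeriesOnBall.iteratedFDeriv_eq_sum_of_completeSpace]
  simp [q, h.symm]

/-- Otherwise `x ^ p` would be `o(x ^ p)` on the right of 0, where it does not vanish. -/
theorem eq_zero_of_const_mul_pow_isBigO {k : ℝ} {p : ℕ}
    (h : (fun x : ℝ => k * x ^ p) =O[𝓝[>] 0] fun x => x ^ (p + 1)) : k = 0 := by
  by_contra hk
  have h1 : (fun x : ℝ => x ^ p) =O[𝓝[>] 0] fun x => x ^ (p + 1) :=
    (isBigO_const_mul_left_iff hk).1 h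
  have h2 : (fun x : ℝ => x ^ (p + 1)) =o[𝓝[>] 0] fun x => x ^ p :=
    (isLittleO_pow_pow (Nat.lt_succ_self p)).mono nhdsWithin_le_nhds
  refine isLittleO_irrefl ?_ (h1.trans_isLittleO h2)
  refine Filter.Eventually.frequently ?_
  filter_upwards [self_mem_nhdsWithin] with x hx
  exact pow_ne_zero _ (ne_of_gt hx)

namespace PlaneTree

variable {N : ℕ} (idx : Tree → Fin N) (rep : Fin N → Tree)

/-- The vector field whose component at a tree with meagre root is the product of the coordinates
at the branches. -/
noncomputable def treeField (y : Fin N → ℝ) (j : Fin N) : ℝ :=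
  match Quotient.out (rep j) with
  | meagre _ c => ∏ i, y (idx (Quotient.mk setoid (c i)))
  | fat _ => 0

/-- The matrix that sends the basis vector of a tree to that of the tree with a fat root grafted
below it. -/
noncomputable def treeMatrix : Matrix (Fin N) (Fin N) ℝ := fun j k =>
  match Quotient.out (rep j) with
  | meagre _ _ => 0
  | fat b => if k = idx (Quotient.mk setoid b) then 1 else 0

theorem contDiff_treeField {n : WithTop ℕ∞} : ContDiff ℝ n (treeField idx rep) := by
  refine contDiff_pi.2 fun j => ?_
  unfold treeField
  cases Quotient.out (rep j) with
  | meagre m c => exact contDiff_prod fun i _ => contDiff_apply ℝ ℝ _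
  | fat b => exact contDiff_const

theorem iteratedFDeriv_treeField_apply (n : ℕ) (v : Fin n → Fin N → ℝ) (j : Fin N) :
    iteratedFDeriv ℝ n (treeField idx rep) 0 v j =
      iteratedFDeriv ℝ n (fun y => treeField idx rep y j) 0 v := by
  have := (ContinuousLinearMap.proj (R := ℝ) (φ := fun _ : Fin N => ℝ) j).iteratedFDeriv_comp_left
    ((contDiff_treeField idx rep (n := n)).contDiffAt (x := 0)) le_rfl
  have h2 := congrArg (fun L => L v) this
  exact h2.symm

variable {idx rep}

/-- At the origin the elementary differential of a tree is a positive multiple of its own basis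
vector. -/
theorem elemDiff_treeField {p : ℕ} (hinj : Function.Injective rep)
    (hrep : ∀ j, (rep j).order ≤ p) (hidx : ∀ τ : Tree, τ.order ≤ p → rep (idx τ) = τ) :
    ∀ t : PlaneTree, order t ≤ p → ∃ κ : ℝ, 0 < κ ∧
      elemDiff (treeField idx rep) (treeMatrix idx rep) 0 t =
        Pi.single (idx (Quotient.mk setoid t)) κ := by
  have hinj' : ∀ s t : PlaneTree, order s ≤ p → order t ≤ p →
      idx (Quotient.mk setoid s) = idx (Quotient.mk setoid t) → Nonempty (Iso s t) := by
    intro s t hs ht h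
    have := congrArg rep h
    rw [hidx (Quotient.mk setoid s) hs, hidx (Quotient.mk setoid t) ht] at this
    exact Quotient.exact this
  have hout : ∀ j (s : PlaneTree), Quotient.out (rep j) = s →
      rep j = Quotient.mk setoid s ∧ order s ≤ p := by
    intro j s h
    have h1 : rep j = Quotient.mk setoid s := by rw [← h]; exact (Quotient.out_eq _).symm
    refine ⟨h1, ?_⟩
    have := hrep j
    rw [h1] at this
    exact this
  -- Translates equality of coordinates into isomorphism of trees.
  have hj : ∀ j (s t : PlaneTree), Quotient.out (rep j) = s → order t ≤ p →
      (j = idx (Quotient.mk setoid t) ↔ Nonempty (Iso s t)) := by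
    intro j s t h ht
    obtain ⟨h1, h2⟩ := hout j s h
    have : j = idx (Quotient.mk setoid s) := hinj (by rw [hidx (Quotient.mk setoid s) h2, h1])
    constructor
    · exact fun h => hinj' s t h2 ht (this.symm.trans h)
    · rintro i
      rw [this, show Quotient.mk setoid s = Quotient.mk setoid t from Quotient.sound i]
  intro t
  induction t with
  | meagre n d ih =>
    intro ht
    have hd : ∀ i, order (d i) ≤ p := fun i => by
      rw [order_meagre] at ht
      exact (Finset.single_le_sum (fun k _ => Nat.zero_le (order (d k)))
        (Finset.mem_univ i)).trans (by omega)
    choose κ hκ hF using fun i => ih i (hd i)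
    have hcomp : ∀ j, iteratedFDeriv ℝ n (treeField idx rep) 0
        (fun i => Pi.single (idx (Quotient.mk setoid (d i))) (κ i)) j = 0 ∨
        j = idx (Quotient.mk setoid (meagre n d)) := by
      intro j
      rw [iteratedFDeriv_treeField_apply]
      unfold treeField
      rcases hs : Quotient.out (rep j) with ⟨m, c⟩ | b
      · by_cases hmn : n = m
        · subst hmn
          rw [or_iff_not_imp_right, hj j _ _ hs ht]
          intro hne
          refine (iteratedFDeriv_coordProd _ _ _).trans (Finset.sum_eq_zero fun σ _ => ?_)
          -- A non-zero term would match each branch `c i` with an isomorphic `d (σ i)`, and so give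
          -- an isomorphism of the whole trees.
          by_contra h0
          rw [← ne_eq, Finset.prod_ne_zero_iff] at h0
          have hc : ∀ i, order (c i) ≤ p := fun i => by
            have := (hout j _ hs).2
            rw [order_meagre] at this
            exact (Finset.single_le_sum (fun k _ => Nat.zero_le (order (c k)))
              (Finset.mem_univ i)).trans (by omega)
          have : ∀ i, Nonempty (Iso (c i) (d (σ i))) := fun i => by
            refine hinj' _ _ (hc i) (hd _) ?_
            by_contra hi
            exact h0 i (Finset.mem_univ i) (Pi.single_eq_of_ne hi _)
          exact hne ⟨⟨σ, fun i => (this i).some⟩⟩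
        · exact Or.inl (iteratedFDeriv_coordProd_of_ne hmn _ _)
      · left
        simp
    have hpos : 0 < iteratedFDeriv ℝ n (treeField idx rep) 0
        (fun i => Pi.single (idx (Quotient.mk setoid (d i))) (κ i))
        (idx (Quotient.mk setoid (meagre n d))) := by
      rw [iteratedFDeriv_treeField_apply]
      unfold treeField
      rcases hs : Quotient.out (rep (idx (Quotient.mk setoid (meagre n d)))) with ⟨m, c⟩ | b
      · obtain ⟨e, iso⟩ := (hj _ _ _ hs ht).1 rfl
        obtain rfl : m = n := by simpa using Fintype.card_congr e
        refine lt_of_lt_of_eq ?_ (iteratedFDeriv_coordProd _ _ _).symm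
        -- Positivity of `κ` in the induction excludes cancellation: all terms are non-negative, and
        -- the permutation underlying the isomorphism contributes a positive one.
        refine Finset.sum_pos' (fun σ _ => Finset.prod_nonneg fun i _ => ?_)
          ⟨e, Finset.mem_univ _, Finset.prod_pos fun i _ => ?_⟩
        · rw [Pi.single_apply]
          split_ifs
          · exact (hκ _).le
          · exact le_rfl
        · rw [show Quotient.mk setoid (c i) = Quotient.mk setoid (d (e i)) from
            Quotient.sound ⟨iso i⟩, Pi.single_eq_same]
          exact hκ _
      · obtain ⟨i⟩ := (hj _ _ _ hs ht).1 rfl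
        exact i.elim
    refine ⟨_, hpos, ?_⟩
    rw [elemDiff]
    simp only [hF]
    funext j
    rcases eq_or_ne j (idx (Quotient.mk setoid (meagre n d))) with rfl | hne
    · rw [Pi.single_eq_same]
    · rw [Pi.single_eq_of_ne hne, (hcomp j).resolve_right hne]
  | fat b ih =>
    intro ht
    have hb : order b ≤ p := by rw [order_fat] at ht; omega
    obtain ⟨κ, hκ, hF⟩ := ih hb
    refine ⟨κ, hκ, ?_⟩
    rw [elemDiff, hF]
    funext j
    rw [Matrix.mulVec_single, Pi.single_apply]
    simp only [Pi.smul_apply, Matrix.col_apply, MulOpposite.smul_eq_mul_unop,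
      MulOpposite.unop_op, treeMatrix]
    rcases hs : Quotient.out (rep j) with ⟨m, c⟩ | b'
    · rw [if_neg, zero_mul]
      rw [hj j _ _ hs ht]
      rintro ⟨i⟩
      exact i.elim
    · have hb' : order b' ≤ p := by
        have := (hout j _ hs).2
        rw [order_fat] at this
        omega
      -- Adding a fat root is injective on isomorphism classes, so the column at `b` has its only
      -- entry 1 in the row of `fat b`.
      have : idx (Quotient.mk setoid b) = idx (Quotient.mk setoid b') ↔
          j = idx (Quotient.mk setoid (fat b)) := by
        rw [hj j _ _ hs ht]
        constructor
        · exact fun h => hinj' b' b hb' hb h.symm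
        · intro i
          rw [show Quotient.mk setoid b' = Quotient.mk setoid b from Quotient.sound i]
      simp only [this]
      split_ifs <;> simp

end PlaneTree

theorem Tree.order_pos (τ : Tree) : 0 < τ.order :=
  Quotient.inductionOn τ PlaneTree.order_pos

theorem Tree.symmetry_ne_zero (τ : Tree) : τ.symmetry ≠ 0 :=
  Quotient.inductionOn τ PlaneTree.symmetry_ne_zero

/-- For each order there are a smooth vector field and a matrix for which, at the origin, the
elementary differentials of the trees up to this order are separated by coordinates. -/
theorem exists_separating_field (p : ℕ) (hp : 0 < p) :
    ∃ (N : ℕ) (f : (Fin N → ℝ) → (Fin N → ℝ)) (A : Matrix (Fin N) (Fin N) ℝ) (idx : Tree → Fin N),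
      ContDiff ℝ ∞ f ∧ ∀ τ : Tree, τ.order ≤ p → τ.elemDiff f A 0 (idx τ) ≠ 0 ∧
        ∀ ρ : Tree, ρ.order ≤ p → ρ ≠ τ → ρ.elemDiff f A 0 (idx τ) = 0 := by
  classical
  let S := (Tree.finite_order_le p).toFinset
  have hS : ∀ τ, τ ∈ S ↔ τ.order ≤ p := fun τ =>
    Set.Finite.mem_toFinset (Tree.finite_order_le p)
  let rep : Fin S.card → Tree := fun j => (S.equivFin.symm j).1
  have hinj : Function.Injective rep := Subtype.val_injective.comp S.equivFin.symm.injective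
  have hsurj : ∀ τ : Tree, τ.order ≤ p → ∃ j, rep j = τ := fun τ h =>
    ⟨S.equivFin ⟨τ, (hS τ).2 h⟩, by simp [rep]⟩
  -- The one-node tree makes the coordinate set non-empty, which `Function.invFun` needs as a
  -- default value.
  let leaf : Tree := Quotient.mk PlaneTree.setoid (PlaneTree.meagre 0 Fin.elim0)
  have hleaf : leaf.order ≤ p := by
    change PlaneTree.order _ ≤ p
    rw [PlaneTree.order_meagre]
    simp only [Finset.univ_eq_empty, Finset.sum_empty]
    omega
  obtain ⟨j₀, -⟩ := hsurj leaf hleaf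
  have : Nonempty (Fin S.card) := ⟨j₀⟩
  have hidx : ∀ τ : Tree, τ.order ≤ p → rep (Function.invFun rep τ) = τ := fun τ h =>
    Function.invFun_eq (hsurj τ h)
  have key := PlaneTree.elemDiff_treeField hinj (fun j => (hS _).1 (S.equivFin.symm j).2) hidx
  have hout : ∀ τ : Tree, Quotient.mk PlaneTree.setoid (Quotient.out τ) = τ :=
    fun τ => Quotient.out_eq τ
  have hord : ∀ τ : Tree, PlaneTree.order (Quotient.out τ) = τ.order := fun τ =>
    congrArg Tree.order (hout τ)
  refine ⟨S.card, PlaneTree.treeField (Function.invFun rep) rep,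
    PlaneTree.treeMatrix (Function.invFun rep) rep, Function.invFun rep,
    PlaneTree.contDiff_treeField _ _, fun τ hτ => ⟨?_, fun ρ hρ hne => ?_⟩⟩
  · obtain ⟨κ, hκ, h⟩ := key (Quotient.out τ) ((hord τ).trans_le hτ)
    rw [Tree.elemDiff, h, hout, Pi.single_eq_same]
    exact hκ.ne'
  · obtain ⟨κ, hκ, h⟩ := key (Quotient.out ρ) ((hord ρ).trans_le hρ)
    rw [Tree.elemDiff, h, hout, Pi.single_eq_of_ne]
    intro h
    have := congrArg rep h
    rw [hidx _ hτ, hidx _ hρ] at this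
    exact hne this.symm

/-! ### Uniqueness of the coefficients. -/

theorem exists_isExactSolution {N : ℕ} {f : (Fin N → ℝ) → (Fin N → ℝ)} (y₀ : Fin N → ℝ)
    (hf : ContDiffAt ℝ 1 f y₀) :
    ∃ (t₁ : ℝ) (y : ℝ → (Fin N → ℝ)), 0 < t₁ ∧ y 0 = y₀ ∧ IsExactSolution f 0 t₁ y := by
  obtain ⟨y, hy, ε, hε, h⟩ :=
    hf.exists_forall_mem_closedBall_exists_eq_forall_mem_Ioo_hasDerivAt₀ 0
  exact ⟨ε / 2, y, half_pos hε, hy, fun t ht =>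
    (h t ⟨by linarith [ht.1], by linarith [ht.2]⟩).hasDerivWithinAt⟩

/-- Both series expand the same solution, which exists locally by Picard–Lindelöf and cancels in the
difference. -/
theorem IsExactSolutionCoeff.bSeriesUpTo_sub_isBigO {a b : Option Tree → ℝ}
    (ha : IsExactSolutionCoeff a) (hb : IsExactSolutionCoeff b) {N : ℕ}
    {f : (Fin N → ℝ) → (Fin N → ℝ)} (A : Matrix (Fin N) (Fin N) ℝ) {y₀ : Fin N → ℝ}
    (hf : ContDiffAt ℝ ∞ f y₀) (p : ℕ) (j : Fin N) :
    (fun h => bSeriesUpTo f A a y₀ p h j - bSeriesUpTo f A b y₀ p h j) =O[𝓝[>] 0]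
      fun h : ℝ => h ^ (p + 1) := by
  obtain ⟨t₁, y, ht, hy, hsol⟩ :=
    exists_isExactSolution y₀ (hf.of_le (by exact_mod_cast le_top))
  have h := (hb N f A y y₀ 0 t₁ ht hy hf hsol p).sub (ha N f A y y₀ 0 t₁ ht hy hf hsol p)
  refine (isBigO_pi.1 h j).congr_left fun x => ?_
  simp

/-- The coefficients of the exact solution are unique. -/
theorem IsExactSolutionCoeff.unique {a b : Option Tree → ℝ} (ha : IsExactSolutionCoeff a)
    (hb : IsExactSolutionCoeff b) : a = b := by
  funext o
  rcases o with _ | τ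
  · have h := ha.bSeriesUpTo_sub_isBigO hb (N := 1) (f := fun _ => 0) 0 (y₀ := fun _ => 1)
      contDiffAt_const 0 0
    refine sub_eq_zero.1 (eq_zero_of_const_mul_pow_isBigO (p := 0) (h.congr_left fun x => ?_))
    have h0 : (Tree.finite_order_le 0).toFinset = ∅ := by
      ext τ
      simpa using τ.order_pos.ne'
    unfold bSeriesUpTo
    rw [h0]
    simp
  · obtain ⟨N, f, A, idx, hf, hsep⟩ := exists_separating_field τ.order τ.order_pos
    have h := ha.bSeriesUpTo_sub_isBigO hb A (hf.contDiffAt (x := 0)) τ.order (idx τ)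
    have hB : ∀ (c : Option Tree → ℝ) (x : ℝ), bSeriesUpTo f A c 0 τ.order x (idx τ) =
        c (some τ) * (x ^ τ.order / (τ.symmetry : ℝ)) * τ.elemDiff f A 0 (idx τ) := by
      intro c x
      -- The expansion point 0 removes the constant term, and the coordinate `idx τ` removes every
      -- other tree, of lower order as well; one monomial of degree `τ.order` is left, against an
      -- error one order higher.
      rw [bSeriesUpTo, smul_zero, zero_add, Finset.sum_apply, Finset.sum_eq_single τ]
      · rw [Pi.smul_apply, smul_eq_mul]
      · intro ρ hρ hne
        rw [Pi.smul_apply, (hsep τ le_rfl).2 ρ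
          ((Set.Finite.mem_toFinset (Tree.finite_order_le τ.order)).1 hρ) hne, smul_zero]
      · exact fun h => absurd
          ((Set.Finite.mem_toFinset (Tree.finite_order_le τ.order)).2 (le_refl τ.order)) h
    have h0 := eq_zero_of_const_mul_pow_isBigO
      (k := (a (some τ) - b (some τ)) * (τ.elemDiff f A 0 (idx τ) / (τ.symmetry : ℝ)))
      (h.congr_left fun x => by rw [hB, hB]; ring)
    have hne : τ.elemDiff f A 0 (idx τ) / (τ.symmetry : ℝ) ≠ 0 :=
      div_ne_zero (hsep τ le_rfl).1 (Nat.cast_ne_zero.2 τ.symmetry_ne_zero)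
    exact sub_eq_zero.1 ((mul_eq_zero.1 h0).resolve_right hne)

end TW

theorem mainTheorem2 (a : Option TW.Tree → ℝ) :
    TW.IsExactSolutionCoeff a ↔
      a none = 1 ∧
      (∀ τ : TW.Tree, τ ∉ TW.Tree.T → a (some τ) = 0) ∧
      (∀ τ : TW.Tree, τ ∈ TW.Tree.T → a (some τ) = 1 / (τ.density : ℝ)) := by
  classical
  refine ⟨fun ha => ?_, fun h => TW.isExactSolutionCoeff_of_eq h.1 h.2.1 h.2.2⟩
  let b : Option TW.Tree → ℝ := fun o =>
    o.elim 1 fun τ => if τ ∈ TW.Tree.T then 1 / (τ.density : ℝ) else 0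
  have hfat : ∀ τ : TW.Tree, τ ∉ TW.Tree.T → b (some τ) = 0 := fun τ h => if_neg h
  have hT : ∀ τ : TW.Tree, τ ∈ TW.Tree.T → b (some τ) = 1 / (τ.density : ℝ) :=
    fun τ h => if_pos h
  obtain rfl := ha.unique (TW.isExactSolutionCoeff_of_eq rfl hfat hT)
  exact ⟨rfl, hfat, hT⟩
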